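/- Let $K$ be a quartic number field (that is, $[K:\mathbb{Q}]=4$) with class number $h_K$, discriminant $d_K$ and $r_2$ pairs of complex conjugate embeddings. Let $$b = \frac{n!}{n^{n}}\left(\frac{4}{\pi}\right)^{r_2}|d_K|^{1/2},\qquad n=[K:\mathbb{Q}]=4,$$ be its Minkowski bound. If $b\ge 193$, then $$h_K\le \frac13\, b\log^3 b,$$ where $\log^3 b=(\log b)^3$ and $\log$ is the natural logarithm. -/

import Mathlib

/-- The Minkowski bound `(n! / n ^ n) * (4 / π) ^ r₂ * |d_K| ^ (1 / 2)` of a number field `K` of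
degree `n` and discriminant `d_K`, with `r₂` pairs of complex conjugate embeddings (that is,
`r₂` complex places). -/
noncomputable def minkowskiClassBound (K : Type*) [Field K] [NumberField K] : ℝ :=
  ((Nat.factorial (Module.finrank ℚ K) : ℝ) /
      (Module.finrank ℚ K : ℝ) ^ Module.finrank ℚ K) *
    (4 / Real.pi) ^ NumberField.InfinitePlace.nrComplexPlaces K *
    Real.sqrt |(NumberField.discr K : ℝ)|

open NumberField

/-! By Minkowski every ideal class contains an integral ideal of norm at most b, so the class number
is at most the number of such ideals. At most four primes of K lie above a rational prime p, so they
can be given distinct colours among four. Sending an ideal to the four products of norms of its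
prime factors of each colour is injective, since each coordinate sees at most one prime above p.
Hence h_K is at most the number of 4-tuples of positive integers with product at most b.

Comparison with integrals bounds that count by b(1 + 3L + 3L²/2 + L³/6), L = log b, which suffices
for L ≥ 11. The range 193 ≤ b < 60000 is settled by exact counts on a grid. -/

/-- The number of `k`-tuples of positive integers whose product is at most `N`, in recursive form. -/
def tupleCount : ℕ → ℕ → ℕ
  | 0, N => if 1 ≤ N then 1 else 0
  | k + 1, N => ∑ m ∈ Finset.Ioc 0 N, tupleCount k (N / m)

theorem tupleCount_one (N : ℕ) : tupleCount 1 N = N := by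
  have h : ∀ m ∈ Finset.Ioc 0 N, tupleCount 0 (N / m) = 1 := by
    intro m hm
    rw [Finset.mem_Ioc] at hm
    have : 1 ≤ N / m := (Nat.one_le_div_iff hm.1).2 hm.2
    simp [tupleCount, this]
  rw [tupleCount, Finset.sum_congr rfl h]
  simp

theorem tupleCount_mono (k : ℕ) : Monotone (tupleCount k) := by
  induction k with
  | zero =>
    intro a b h
    simp only [tupleCount]
    split_ifs <;> omega
  | succ k ih =>
    intro a b h
    simp only [tupleCount]
    calc ∑ m ∈ Finset.Ioc 0 a, tupleCount k (a / m)
        ≤ ∑ m ∈ Finset.Ioc 0 a, tupleCount k (b / m) :=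
          Finset.sum_le_sum fun m _ => ih (Nat.div_le_div_right h)
      _ ≤ ∑ m ∈ Finset.Ioc 0 b, tupleCount k (b / m) :=
          Finset.sum_le_sum_of_subset (Finset.Ioc_subset_Ioc_right h)

theorem card_le_tupleCount (k N : ℕ) (T : Finset (Fin k → ℕ)) (hpos : ∀ f ∈ T, ∀ i, 0 < f i)
    (hprod : ∀ f ∈ T, ∏ i, f i ≤ N) : T.card ≤ tupleCount k N := by
  induction k generalizing N with
  | zero =>
    rcases T.eq_empty_or_nonempty with rfl | ⟨f, hf⟩
    · simp
    · have h1 : 1 ≤ N := by simpa using hprod f hf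
      simpa [tupleCount, h1] using Finset.card_le_one_of_subsingleton T
  | succ k ih =>
    have hmap : ∀ f ∈ T, f 0 ∈ Finset.Ioc 0 N := by
      intro f hf
      rw [Finset.mem_Ioc]
      refine ⟨hpos f hf 0, le_trans ?_ (hprod f hf)⟩
      exact Nat.le_of_dvd (Finset.prod_pos fun i _ => hpos f hf i)
        (Finset.dvd_prod_of_mem _ (Finset.mem_univ 0))
    rw [Finset.card_eq_sum_card_fiberwise hmap, tupleCount]
    refine Finset.sum_le_sum fun m hm => ?_
    rw [Finset.mem_Ioc] at hm
    have hinj : Set.InjOn Fin.tail (T.filter fun f => f 0 = m : Set (Fin (k + 1) → ℕ)) := by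
      intro f hf g hg hfg
      simp only [Finset.coe_filter, Set.mem_ofPred_eq] at hf hg
      rw [← Fin.cons_self_tail f, ← Fin.cons_self_tail g, hfg, hf.2, hg.2]
    rw [← Finset.card_image_of_injOn (f := Fin.tail) (by simpa using hinj)]
    refine ih _ _ ?_ ?_
    · intro f hf i
      obtain ⟨g, hg, rfl⟩ := Finset.mem_image.1 hf
      exact hpos g (Finset.mem_filter.1 hg).1 _
    · intro f hf
      obtain ⟨g, hg, rfl⟩ := Finset.mem_image.1 hf
      obtain ⟨hg, h0⟩ := Finset.mem_filter.1 hg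
      rw [Nat.le_div_iff_mul_le hm.1, mul_comm]
      have := hprod g hg
      rw [Fin.prod_univ_succ, h0] at this
      exact this

/-! ### Upper bounds for the tuple counts -/

theorem mul_sub_le_pow_sub_pow {a b : ℝ} (hb : 0 ≤ b) (hab : b ≤ a) (k : ℕ) :
    (k + 1) * b ^ k * (a - b) ≤ a ^ (k + 1) - b ^ (k + 1) := by
  induction k with
  | zero => simp
  | succ k ih =>
    have h0 : 0 ≤ a ^ (k + 1) - b ^ (k + 1) := by
      have := pow_le_pow_left₀ hb hab (k + 1)
      linarith
    have h1 := mul_le_mul_of_nonneg_left ih hb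
    have h2 := mul_le_mul_of_nonneg_right hab h0
    push_cast
    calc ((k : ℝ) + 1 + 1) * b ^ (k + 1) * (a - b)
        = b * ((k + 1) * b ^ k * (a - b)) + b ^ (k + 1) * (a - b) := by ring
      _ ≤ a * (a ^ (k + 1) - b ^ (k + 1)) + b ^ (k + 1) * (a - b) := by linarith
      _ = _ := by ring

-- The n = 1 term is kept, and the rest is compared with the integral of log(y/t)^k / t from 1 to M;
-- the induction telescopes its antiderivative.
open Finset in
theorem sum_log_pow_div_le (y : ℝ) (k M : ℕ) (hM : 1 ≤ M) (hMy : (M : ℝ) ≤ y) :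
    ∑ n ∈ Ioc 0 M, Real.log (y / n) ^ k / n ≤ Real.log y ^ k +
      (Real.log y ^ (k + 1) - Real.log (y / M) ^ (k + 1)) / (k + 1) := by
  induction M, hM using Nat.le_induction with
  | base => simp
  | succ M hM ih =>
    rw [Finset.sum_Ioc_succ_top (Nat.zero_le M)]
    push_cast at hMy ⊢
    have hM0 : (0 : ℝ) < M := by exact_mod_cast hM
    have hy : 0 < y := by linarith
    have ih := ih (by linarith)
    set a := Real.log (y / M) with ha
    set b := Real.log (y / (M + 1)) with hb
    have hb0 : 0 ≤ b := Real.log_nonneg (by rw [le_div_iff₀ (by positivity)]; linarith)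
    have hab : 1 / ((M : ℝ) + 1) ≤ a - b := by
      rw [ha, hb, Real.log_div hy.ne' hM0.ne', Real.log_div hy.ne' (by positivity)]
      -- log t ≥ 1 - 1/t at t = (M+1)/M gives a - b ≥ 1/(M+1).
      have := Real.one_sub_inv_le_log_of_pos (x := ((M : ℝ) + 1) / M) (by positivity)
      rw [Real.log_div (by positivity) hM0.ne'] at this
      have h2 : 1 - (((M : ℝ) + 1) / M)⁻¹ = 1 / ((M : ℝ) + 1) := by field_simp; ring
      linarith
    have hpos : (0 : ℝ) < 1 / ((M : ℝ) + 1) := by positivity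
    have key : (k + 1) * b ^ k * (a - b) ≤ a ^ (k + 1) - b ^ (k + 1) :=
      mul_sub_le_pow_sub_pow hb0 (by linarith) k
    have h3 : b ^ k / ((M : ℝ) + 1) ≤ (a ^ (k + 1) - b ^ (k + 1)) / (k + 1) := by
      rw [le_div_iff₀ (by positivity)]
      refine le_trans ?_ key
      calc b ^ k / ((M : ℝ) + 1) * (k + 1) = (k + 1) * b ^ k * (1 / ((M : ℝ) + 1)) := by ring
        _ ≤ _ := by gcongr
    have h4 : (Real.log y ^ (k + 1) - b ^ (k + 1)) / ((k : ℝ) + 1) =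
      (Real.log y ^ (k + 1) - a ^ (k + 1)) / (k + 1) + (a ^ (k + 1) - b ^ (k + 1)) / (k + 1) := by
      ring
    rw [h4]
    linarith

theorem sum_floor_log_pow_div_le {y : ℝ} (hy : 1 ≤ y) (k : ℕ) :
    ∑ n ∈ Finset.Ioc 0 ⌊y⌋₊, Real.log (y / n) ^ k / n ≤
      Real.log y ^ k + Real.log y ^ (k + 1) / (k + 1) := by
  have h1 : 1 ≤ ⌊y⌋₊ := (Nat.one_le_floor_iff y).2 hy
  have hfl : (⌊y⌋₊ : ℝ) ≤ y := Nat.floor_le (by linarith)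
  have hpos : (0 : ℝ) < ⌊y⌋₊ := by exact_mod_cast h1
  refine (sum_log_pow_div_le y k _ h1 hfl).trans ?_
  have : 0 ≤ Real.log (y / ⌊y⌋₊) :=
    Real.log_nonneg (by rw [le_div_iff₀ hpos]; linarith)
  gcongr
  linarith [pow_nonneg this (k + 1)]

/-- Since ⌊⌊y⌋/n⌋ = ⌊y/n⌋, a bound valid for all real y ≥ 1 can be fed back into the recursion. -/
theorem tupleCount_succ_floor_le {k : ℕ} {P : ℝ → ℝ}
    (h : ∀ y : ℝ, 1 ≤ y → (tupleCount k ⌊y⌋₊ : ℝ) ≤ y * P (Real.log y)) {y : ℝ} (hy : 1 ≤ y) :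
    (tupleCount (k + 1) ⌊y⌋₊ : ℝ) ≤
      y * ∑ n ∈ Finset.Ioc 0 ⌊y⌋₊, P (Real.log (y / n)) / n := by
  rw [tupleCount, Nat.cast_sum, Finset.mul_sum]
  refine Finset.sum_le_sum fun n hn => ?_
  rw [Finset.mem_Ioc] at hn
  have hn0 : (0 : ℝ) < n := by exact_mod_cast hn.1
  have hny : (n : ℝ) ≤ y := (Nat.le_floor_iff (by linarith)).1 hn.2
  rw [← Nat.floor_div_natCast]
  refine (h (y / n) (by rw [le_div_iff₀ hn0]; linarith)).trans (le_of_eq (by ring))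

theorem tupleCount_two_floor_le {y : ℝ} (hy : 1 ≤ y) :
    (tupleCount 2 ⌊y⌋₊ : ℝ) ≤ y * (1 + Real.log y) := by
  have h : ∀ y : ℝ, 1 ≤ y → (tupleCount 1 ⌊y⌋₊ : ℝ) ≤ y * (fun _ => (1 : ℝ)) (Real.log y) := by
    intro y hy
    rw [tupleCount_one, mul_one]
    exact Nat.floor_le (by linarith)
  refine (tupleCount_succ_floor_le (P := fun _ => 1) h hy).trans ?_
  have h0 := sum_floor_log_pow_div_le hy 0
  simp only [pow_zero, Nat.cast_zero, zero_add, pow_one, div_one] at h0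
  gcongr

theorem tupleCount_three_floor_le {y : ℝ} (hy : 1 ≤ y) :
    (tupleCount 3 ⌊y⌋₊ : ℝ) ≤ y * (1 + 2 * Real.log y + Real.log y ^ 2 / 2) := by
  refine (tupleCount_succ_floor_le (P := fun u => 1 + u)
    (fun y hy => tupleCount_two_floor_le hy) hy).trans ?_
  have h0 := sum_floor_log_pow_div_le hy 0
  have h1 := sum_floor_log_pow_div_le hy 1
  simp only [pow_zero, Nat.cast_zero, zero_add, pow_one, div_one, Nat.cast_one] at h0 h1
  gcongr
  simp only [add_div, Finset.sum_add_distrib]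
  norm_num at h0 h1
  norm_num
  linarith

theorem tupleCount_four_floor_le {y : ℝ} (hy : 1 ≤ y) :
    (tupleCount 4 ⌊y⌋₊ : ℝ) ≤
      y * (1 + 3 * Real.log y + 3 / 2 * Real.log y ^ 2 + Real.log y ^ 3 / 6) := by
  refine (tupleCount_succ_floor_le (P := fun u => 1 + 2 * u + u ^ 2 / 2)
    (fun y hy => tupleCount_three_floor_le hy) hy).trans ?_
  have h0 := sum_floor_log_pow_div_le hy 0
  have h1 := sum_floor_log_pow_div_le hy 1
  have h2 := sum_floor_log_pow_div_le hy 2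
  have e : ∀ n : ℕ, (1 + 2 * Real.log (y / n) + Real.log (y / n) ^ 2 / 2) / n =
      Real.log (y / n) ^ 0 / n + 2 * (Real.log (y / n) ^ 1 / n) +
        1 / 2 * (Real.log (y / n) ^ 2 / n) := fun n => by ring
  gcongr
  simp only [e, Finset.sum_add_distrib, ← Finset.mul_sum]
  norm_num at h0 h1 h2 ⊢
  linarith

/-! ### Exact evaluation by blocks of equal quotients -/

/-- For a weakly decreasing function `m ↦ g (N / m)`, the sum over `k < m ≤ N`, evaluated block by
block over the intervals on which `N / m` is constant. The first argument bounds the number of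
blocks. The matches force the kernel to evaluate the quotients. -/
def blockSum (g : ℕ → ℕ) (N : ℕ) : ℕ → ℕ → ℕ
  | 0, _ => 0
  | fuel + 1, k =>
    match N / (k + 1) with
    | 0 => 0
    | q + 1 =>
      match N / (q + 1) with
      | 0 => 0
      | j + 1 => (j + 1 - k) * g (q + 1) + blockSum g N fuel (j + 1)

theorem blockSum_eq (g : ℕ → ℕ) (N fuel k : ℕ) (h : N ≤ fuel + k) :
    blockSum g N fuel k = ∑ m ∈ Finset.Ioc k N, g (N / m) := by
  induction fuel generalizing k with
  | zero => rw [blockSum, Finset.Ioc_eq_empty (by omega), Finset.sum_empty]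
  | succ fuel ih =>
    rw [blockSum]
    rcases hq : N / (k + 1) with _ | q
    · have hk : N < k + 1 := (Nat.div_eq_zero_iff_lt (Nat.succ_pos k)).1 hq
      simp [Finset.Ioc_eq_empty (show ¬ k < N by omega)]
    have h1 : (q + 1) * (k + 1) ≤ N := by rw [← hq]; exact Nat.div_mul_le_self _ _
    have h2 : k + 1 ≤ N / (q + 1) := by
      rw [Nat.le_div_iff_mul_le (Nat.succ_pos q), mul_comm]; exact h1
    rcases hj : N / (q + 1) with _ | j
    · omega
    have hkj : k + 1 ≤ j + 1 := hj ▸ h2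
    have hjN : j + 1 ≤ N := hj ▸ Nat.div_le_self _ _
    simp only [hj]
    rw [ih _ (by omega), ← Finset.sum_Ioc_consecutive _ (show k ≤ j + 1 by omega) hjN]
    congr 1
    rw [Finset.sum_congr rfl (g := fun _ => g (q + 1))]
    · simp
    · intro m hm
      rw [Finset.mem_Ioc] at hm
      congr 1
      apply le_antisymm
      · rw [← hq]; exact Nat.div_le_div_left (by omega) (Nat.succ_pos k)
      · rw [Nat.le_div_iff_mul_le (by omega), mul_comm, ← Nat.le_div_iff_mul_le (by omega), hj]
        exact hm.2

theorem blockSum_self (g : ℕ → ℕ) (N : ℕ) :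
    blockSum g N N 0 = ∑ m ∈ Finset.Ioc 0 N, g (N / m) :=
  blockSum_eq g N N 0 (Nat.add_zero N).ge

/-- `tupleCount 4`, in a form that the kernel evaluates quickly. -/
def fastCount (N : ℕ) : ℕ :=
  blockSum (fun a => blockSum (fun b => blockSum id b b 0) a a 0) N N 0

theorem fastCount_eq (N : ℕ) : fastCount N = tupleCount 4 N := by
  have h2 : (fun b => blockSum id b b 0) = tupleCount 2 := by
    funext b
    rw [show tupleCount 2 b = ∑ m ∈ Finset.Ioc 0 b, tupleCount 1 (b / m) from rfl, blockSum_self]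
    simp only [tupleCount_one, id]
  have h3 : (fun a => blockSum (tupleCount 2) a a 0) = tupleCount 3 :=
    funext fun a => blockSum_self _ a
  rw [fastCount, h2, h3]
  exact blockSum_self _ N

/-! ### Encoding ideals as tuples -/

theorem prod_map_filter_eq {α ι M : Type*} [CommMonoid M] [Fintype ι] [DecidableEq ι] (c : α → ι)
    (f : α → M) (s : Multiset α) :
    ∏ i, ((s.filter (c · = i)).map f).prod = (s.map f).prod := by
  induction s using Multiset.induction with
  | empty => simp
  | cons a s ih =>
    have h (i : ι) : (((a ::ₘ s).filter (c · = i)).map f).prod =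
        (if c a = i then f a else 1) * ((s.filter (c · = i)).map f).prod := by
      split_ifs with h <;> simp [h]
    simp only [h, Finset.prod_mul_distrib, ih]
    simp

theorem Finset.exists_injOn_fin {α : Type*} (T : Finset α) {d : ℕ} (hd : 0 < d)
    (hT : T.card ≤ d) : ∃ f : α → Fin d, Set.InjOn f T := by
  classical
  refine ⟨fun a => if h : a ∈ T then Fin.castLE hT (T.equivFin ⟨a, h⟩) else ⟨0, hd⟩, ?_⟩
  intro a ha b hb hab
  rw [Finset.mem_coe] at ha hb
  simpa [ha, hb] using hab

section

variable {K : Type*} [Field K] [NumberField K]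

theorem absNorm_eq_minFac_pow (P : Ideal (𝓞 K)) [P.IsMaximal] :
    (P.absNorm.minFac).Prime ∧ ((P.absNorm.minFac : ℕ) : 𝓞 K) ∈ P ∧
      ∃ n, 0 < n ∧ P.absNorm = P.absNorm.minFac ^ n := by
  obtain ⟨p, n, hn, hmem, hp, h⟩ := Ideal.exists_prime_and_absNorm_eq_pow P
  have : P.absNorm.minFac = p := by rw [h]; exact hp.pow_minFac hn.ne'
  rw [this]
  exact ⟨hp, hmem, n, hn, h⟩

/-- The sum of e·f over the primes above p is the degree, and each term is at least 1. -/
theorem card_primesOverFinset_span_le {p : ℕ} (hp : p.Prime) :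
    (IsDedekindDomain.primesOverFinset (Ideal.span {(p : ℤ)}) (𝓞 K)).card ≤
      Module.finrank ℚ K := by
  have hp0 : Ideal.span {(p : ℤ)} ≠ ⊥ := by simpa using hp.ne_zero
  have : (Ideal.span {(p : ℤ)}).IsMaximal :=
    ((Ideal.span_singleton_prime (by exact_mod_cast hp.ne_zero)).2
      (Nat.prime_iff_prime_int.1 hp)).isMaximal hp0
  have hcoe := IsDedekindDomain.coe_primesOverFinset hp0 (𝓞 K)
  have : Fintype ((Ideal.span {(p : ℤ)}).primesOver (𝓞 K)) :=
    Fintype.ofFinset (IsDedekindDomain.primesOverFinset (Ideal.span {(p : ℤ)}) (𝓞 K))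
      fun P => IsDedekindDomain.mem_primesOverFinset_iff hp0 (𝓞 K)
  rw [← RingOfIntegers.rank K,
    ← Ideal.sum_ramification_inertia_eq_finrank (Ideal.span {(p : ℤ)}) (𝓞 K),
    ← Set.ncard_coe_finset, hcoe, ← Nat.card_coe_set_eq, Nat.card_eq_fintype_card,
    ← Finset.card_univ, Finset.card_eq_sum_ones]
  refine Finset.sum_le_sum fun P _ => ?_
  have := P.2.1
  exact Nat.mul_pos (Ideal.ramificationIdx_pos _ _) (Ideal.inertiaDeg_pos _ _)

theorem mem_primesOverFinset_span (P : Ideal (𝓞 K)) [hP : P.IsMaximal] :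
    P ∈ IsDedekindDomain.primesOverFinset (Ideal.span {(P.absNorm.minFac : ℤ)}) (𝓞 K) := by
  obtain ⟨hp, hmem, -⟩ := absNorm_eq_minFac_pow P
  have hp0 : Ideal.span {(P.absNorm.minFac : ℤ)} ≠ ⊥ := by simpa using hp.ne_zero
  have hmax : (Ideal.span {(P.absNorm.minFac : ℤ)}).IsMaximal :=
    ((Ideal.span_singleton_prime (by exact_mod_cast hp.ne_zero)).2
      (Nat.prime_iff_prime_int.1 hp)).isMaximal hp0
  rw [IsDedekindDomain.mem_primesOverFinset_iff hp0]
  refine ⟨hP.isPrime, ⟨hmax.eq_of_le ?_ ?_⟩⟩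
  · exact (Ideal.IsPrime.comap (algebraMap ℤ (𝓞 K))).ne_top
  · rw [Ideal.span_singleton_le_iff_mem, Ideal.mem_comap]
    simpa using hmem

variable (K) in
/-- The maximal ideals can be coloured with `[K : ℚ]` colours so that ideals above the same prime
number have different colours. -/
theorem exists_colouring : ∃ c : Ideal (𝓞 K) → Fin (Module.finrank ℚ K),
    ∀ P Q : Ideal (𝓞 K), P.IsMaximal → Q.IsMaximal →
      P.absNorm.minFac = Q.absNorm.minFac → c P = c Q → P = Q := by
  have h : ∀ p : ℕ, ∃ f : Ideal (𝓞 K) → Fin (Module.finrank ℚ K), p.Prime →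
      Set.InjOn f (IsDedekindDomain.primesOverFinset (Ideal.span {(p : ℤ)}) (𝓞 K)) := by
    intro p
    by_cases hp : p.Prime
    · obtain ⟨f, hf⟩ := Finset.exists_injOn_fin _ (Module.finrank_pos (R := ℚ) (M := K))
        (card_primesOverFinset_span_le hp)
      exact ⟨f, fun _ => hf⟩
    · exact ⟨fun _ => ⟨0, Module.finrank_pos⟩, fun h => absurd h hp⟩
  choose f hf using h
  refine ⟨fun P => f P.absNorm.minFac P, fun P Q hP hQ hPQ hc => ?_⟩
  refine hf _ (absNorm_eq_minFac_pow P).1 (mem_primesOverFinset_span P) ?_ ?_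
  · rw [hPQ]; exact mem_primesOverFinset_span Q
  · simpa only [hPQ] using hc

-- Only copies of P contribute to the exponent of its residue characteristic, so that exponent
-- recovers the multiplicity of P.
open scoped Classical in
theorem factorization_prod_absNorm (P : Ideal (𝓞 K)) [P.IsMaximal]
    (s : Multiset (Ideal (𝓞 K))) (hmax : ∀ Q ∈ s, Q.IsMaximal)
    (huniq : ∀ Q ∈ s, P.absNorm.minFac = Q.absNorm.minFac → P = Q) :
    (s.map Ideal.absNorm).prod.factorization P.absNorm.minFac =
      s.count P * P.absNorm.factorization P.absNorm.minFac := by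
  have hne (Q : Ideal (𝓞 K)) (hQ : Q.IsMaximal) : Q.absNorm ≠ 0 := by
    obtain ⟨hq, -, n, -, h⟩ := absNorm_eq_minFac_pow Q
    rw [h]
    exact pow_ne_zero _ hq.ne_zero
  induction s using Multiset.induction with
  | empty => simp
  | cons Q s ih =>
    have hQ := hmax Q (Multiset.mem_cons_self _ _)
    have ih := ih (fun R hR => hmax R (Multiset.mem_cons_of_mem hR))
      (fun R hR => huniq R (Multiset.mem_cons_of_mem hR))
    have hs : (s.map Ideal.absNorm).prod ≠ 0 := by
      refine Multiset.prod_ne_zero fun h0 => ?_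
      obtain ⟨R, hR, hR0⟩ := Multiset.mem_map.1 h0
      exact hne R (hmax R (Multiset.mem_cons_of_mem hR)) hR0
    rw [Multiset.map_cons, Multiset.prod_cons, Nat.factorization_mul (hne Q hQ) hs,
      Finsupp.add_apply, ih, Multiset.count_cons]
    split_ifs with h
    · subst h; ring
    · have hpq := fun e => h (huniq Q (Multiset.mem_cons_self _ _) e)
      obtain ⟨hq, -, n, -, hn⟩ := absNorm_eq_minFac_pow Q
      rw [hn, hq.factorization_pow, Finsupp.single_eq_of_ne hpq]
      ring

open scoped Classical in
theorem exists_injOn_prod_eq_absNorm : ∃ Φ : Ideal (𝓞 K) → Fin (Module.finrank ℚ K) → ℕ,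
    Set.InjOn Φ {I | I ≠ ⊥} ∧ ∀ I ≠ ⊥, ∏ i, Φ I i = I.absNorm := by
  obtain ⟨c, hc⟩ := exists_colouring K
  have hmax {I P : Ideal (𝓞 K)} (h : P ∈ UniqueFactorizationMonoid.normalizedFactors I) :
      P.IsMaximal := by
    have hP := UniqueFactorizationMonoid.prime_of_normalized_factor P h
    exact (Ideal.isPrime_of_prime hP).isMaximal hP.ne_zero
  refine ⟨fun I i => (((UniqueFactorizationMonoid.normalizedFactors I).filter (c · = i)).map
    Ideal.absNorm).prod, fun I hI J hJ h => ?_, fun I hI => ?_⟩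
  · have : UniqueFactorizationMonoid.normalizedFactors I =
        UniqueFactorizationMonoid.normalizedFactors J := by
      ext P
      by_cases hP : P.IsMaximal
      · have hi := congrArg (fun n => n.factorization P.absNorm.minFac) (congrFun h (c P))
        simp only at hi
        rw [factorization_prod_absNorm P, factorization_prod_absNorm P,
          Multiset.count_filter_of_pos (p := (c · = c P)) rfl,
          Multiset.count_filter_of_pos (p := (c · = c P)) rfl] at hi
        -- The exponent of p in the norm of P is positive, so it cancels.
        · refine Nat.eq_of_mul_eq_mul_right ?_ hi
          obtain ⟨hp, -, n, hn, e⟩ := absNorm_eq_minFac_pow P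
          exact hp.factorization_pos_of_dvd (by rw [e]; exact pow_ne_zero _ hp.ne_zero)
            (Nat.minFac_dvd _)
        all_goals
          intro Q hQ
          rw [Multiset.mem_filter] at hQ
        · exact hmax hQ.1
        · exact fun e => hc P Q hP (hmax hQ.1) e hQ.2.symm
        · exact hmax hQ.1
        · exact fun e => hc P Q hP (hmax hQ.1) e hQ.2.symm
      · rw [Multiset.count_eq_zero_of_notMem fun h => hP (hmax h),
          Multiset.count_eq_zero_of_notMem fun h => hP (hmax h)]
    rw [← Ideal.prod_normalizedFactors_eq_self hI, this, Ideal.prod_normalizedFactors_eq_self hJ]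
  · rw [prod_map_filter_eq, ← map_multiset_prod, Ideal.prod_normalizedFactors_eq_self hI]

theorem card_ideals_le_tupleCount (N : ℕ) (T : Finset (Ideal (𝓞 K)))
    (hT : ∀ I ∈ T, I ≠ ⊥ ∧ I.absNorm ≤ N) :
    T.card ≤ tupleCount (Module.finrank ℚ K) N := by
  obtain ⟨Φ, hinj, hprod⟩ := exists_injOn_prod_eq_absNorm (K := K)
  rw [← Finset.card_image_of_injOn (hinj.mono fun I hI => (hT I hI).1)]
  apply card_le_tupleCount
  · intro f hf i
    obtain ⟨I, hI, rfl⟩ := Finset.mem_image.1 hf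
    have h := hprod I (hT I hI).1
    refine Nat.pos_of_ne_zero fun h0 => ?_
    rw [Finset.prod_eq_zero (Finset.mem_univ i) h0] at h
    exact (hT I hI).1 (Ideal.absNorm_eq_zero_iff.1 h.symm)
  · intro f hf
    obtain ⟨I, hI, rfl⟩ := Finset.mem_image.1 hf
    rw [hprod I (hT I hI).1]
    exact (hT I hI).2

theorem classNumber_le_tupleCount {b : ℝ}
    (h : ∀ C : ClassGroup (𝓞 K), ∃ I : nonZeroDivisors (Ideal (𝓞 K)), ClassGroup.mk0 I = C ∧
      ((I : Ideal (𝓞 K)).absNorm : ℝ) ≤ b) :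
    classNumber K ≤ tupleCount (Module.finrank ℚ K) ⌊b⌋₊ := by
  classical
  choose F hF hFb using h
  have hinj : Function.Injective fun C => (F C : Ideal (𝓞 K)) := by
    intro C D hCD
    rw [← hF C, ← hF D, Subtype.ext hCD]
  rw [classNumber, ← Finset.card_univ, ← Finset.card_image_of_injective _ hinj]
  apply card_ideals_le_tupleCount
  intro I hI
  obtain ⟨C, -, rfl⟩ := Finset.mem_image.1 hI
  exact ⟨nonZeroDivisors.coe_ne_zero (F C), Nat.le_floor (hFb C)⟩

end

/-! ### Numerical verification and conclusion -/

/-- Check that `tupleCount 4 (y - 1) ≤ x (log x) ^ 3 / 3` for consecutive entries `(x, p)` and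
`(y, _)` of a list, where `p / 1000` is a lower bound of `log x`. -/
def checkGrid : List (ℕ × ℕ) → Bool
  | (x, p) :: (y, q) :: l =>
    Nat.ble (27183 ^ p) (x ^ 1000 * 10000 ^ p) &&
      Nat.ble (3 * 1000 ^ 3 * fastCount (y - 1)) (x * p ^ 3) && checkGrid ((y, q) :: l)
  | _ => true

/-- As e < 2.7183, the integer inequality gives exp(p) ≤ x^1000. -/
theorem div_thousand_le_log {x p : ℕ}
    (h : 27183 ^ p ≤ x ^ 1000 * 10000 ^ p) : (p : ℝ) / 1000 ≤ Real.log x := by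
  have hx : x ≠ 0 := by
    rintro rfl
    simp at h
  have hx' : (0 : ℝ) < x := by exact_mod_cast hx.bot_lt
  have h1 : (27183 : ℝ) ^ p ≤ x ^ 1000 * 10000 ^ p := by exact_mod_cast h
  have h2 : Real.exp p ≤ (x : ℝ) ^ 1000 := by
    rw [← Real.exp_one_pow]
    calc Real.exp 1 ^ p ≤ (27183 / 10000 : ℝ) ^ p := by
          gcongr
          linarith [Real.exp_one_lt_d9]
      _ ≤ _ := by rw [div_pow, div_le_iff₀ (by positivity)]; exact h1
  have h3 := (Real.le_log_iff_exp_le (by positivity)).2 h2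
  rw [Real.log_pow] at h3
  rw [div_le_iff₀ (by norm_num)]
  push_cast at h3
  linarith

theorem mul_log_pow_three_le {a b c : ℝ} (ha : 0 < a) (hc : 0 ≤ c) (hca : c ≤ Real.log a)
    (hab : a ≤ b) : a * c ^ 3 ≤ b * Real.log b ^ 3 := by
  have hl : c ≤ Real.log b := hca.trans (Real.log_le_log ha hab)
  have hb : 0 ≤ b := by linarith
  gcongr

/-- Both sides increase with b, so on [x, y) it suffices to compare the count at y - 1 with the
right side at x. -/
theorem tupleCount_le_of_checkGrid (l : List (ℕ × ℕ)) (x p : ℕ)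
    (h : checkGrid ((x, p) :: l) = true) {b : ℝ} (hxb : (x : ℝ) ≤ b)
    (hlast : b < (((x, p) :: l).getLast (by simp)).1) :
    (tupleCount 4 ⌊b⌋₊ : ℝ) ≤ 1 / 3 * b * Real.log b ^ 3 := by
  induction l generalizing x p with
  | nil => simp only [List.getLast_singleton] at hlast; linarith
  | cons yq l ih =>
    obtain ⟨y, q⟩ := yq
    simp only [checkGrid, Bool.and_eq_true, Nat.ble_eq] at h
    obtain ⟨⟨h1, h2⟩, h3⟩ := h
    have hx : x ≠ 0 := by
      rintro rfl
      simp at h1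
    have hx' : (0 : ℝ) < x := by exact_mod_cast hx.bot_lt
    rcases le_or_gt (y : ℝ) b with hy | hy
    · exact ih y q h3 hy (by simpa using hlast)
    · have hfl : ⌊b⌋₊ ≤ y - 1 := by
        have := (Nat.floor_lt (by linarith)).2 hy
        omega
      have h4 : (tupleCount 4 ⌊b⌋₊ : ℝ) ≤ fastCount (y - 1) := by
        rw [fastCount_eq]
        exact_mod_cast tupleCount_mono 4 hfl
      have h5 : (3 : ℝ) * 1000 ^ 3 * fastCount (y - 1) ≤ x * p ^ 3 := by exact_mod_cast h2
      have h6 := mul_log_pow_three_le hx' (by positivity) (div_thousand_le_log h1) hxb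
      rw [div_pow] at h6
      linarith

theorem tupleCount_four_le_of_lt {b : ℝ} (hb : 193 ≤ b) (hb' : b < 60000) :
    (tupleCount 4 ⌊b⌋₊ : ℝ) ≤ 1 / 3 * b * Real.log b ^ 3 := by
  refine tupleCount_le_of_checkGrid
    [(195, 5272), (198, 5288), (200, 5298), (203, 5313), (207, 5332), (210, 5347),
    (216, 5375), (220, 5393), (224, 5411), (228, 5429), (234, 5455), (240, 5480), (246, 5505),
    (252, 5529), (260, 5560), (270, 5598), (280, 5634), (288, 5662), (300, 5703), (312, 5742),
    (325, 5783), (340, 5828), (360, 5886), (383, 5947), (408, 6011), (434, 6073), (465, 6141),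
    (504, 6222), (544, 6298), (592, 6383), (648, 6473), (715, 6572), (792, 6674), (882, 6782),
    (990, 6897), (1120, 7021), (1272, 7148), (1452, 7280), (1674, 7422), (1944, 7572),
    (2268, 7726), (2668, 7889), (3168, 8060), (3780, 8237), (4556, 8424), (5538, 8619),
    (6780, 8821), (8370, 9032), (10416, 9251), (13068, 9477), (16530, 9712), (21087, 9956),
    (27120, 10207), (35154, 10467), (45942, 10735), (60000, 11000)]
    193 5262 (by decide +kernel) (by exact_mod_cast hb) (by simpa using hb')

theorem tupleCount_four_le {b : ℝ} (hb : 193 ≤ b) :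
    (tupleCount 4 ⌊b⌋₊ : ℝ) ≤ 1 / 3 * b * Real.log b ^ 3 := by
  rcases lt_or_ge b 60000 with h | h
  · exact tupleCount_four_le_of_lt hb h
  · refine (tupleCount_four_floor_le (by linarith)).trans ?_
    have h1 := div_thousand_le_log (x := 60000) (p := 11000) (by decide +kernel)
    have h2 : 11 ≤ Real.log b := by
      refine le_trans ?_ (Real.log_le_log (by norm_num) h)
      norm_num at h1 ⊢
      linarith
    rw [mul_comm (1 / 3) b, mul_assoc]
    gcongr
    -- It remains that 1 + 3L + 3L²/2 ≤ L³/6 for L ≥ 11; at L = 11 this reads 215.5 ≤ 221.8….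
    nlinarith [mul_nonneg (sub_nonneg.2 h2) (sub_nonneg.2 h2), sq_nonneg (Real.log b),
      mul_nonneg (mul_nonneg (sub_nonneg.2 h2) (sub_nonneg.2 h2)) (sub_nonneg.2 h2)]

theorem corollary1 (K : Type*) [Field K] [NumberField K]
    (hdeg : Module.finrank ℚ K = 4)
    (hb : 193 ≤ minkowskiClassBound K) :
    (NumberField.classNumber K : ℝ) ≤
      (1 / 3) * minkowskiClassBound K * Real.log (minkowskiClassBound K) ^ 3 := by
  refine le_trans ?_ (tupleCount_four_le hb)
  rw [← hdeg]
  refine Nat.cast_le.2 (classNumber_le_tupleCount fun C => ?_)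
  obtain ⟨I, hI, hle⟩ := exists_ideal_in_class_of_norm_le C
  refine ⟨I, hI, hle.trans (le_of_eq ?_)⟩
  rw [minkowskiClassBound]
  ring
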